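/- Let $n \ge 1$ and let $1 \le k_1 \le k_2 \le \dots \le k_n$ be integers; write $\mathbf{k} = (k_1,\dots,k_n)$, $[m] = \{1,\dots,m\}$. For $1 \le r \le n$ let $$\mathcal{L}_{\mathbf{k},r} = \bigl\{ \{(x,y_x) : x \in X\} \;:\; X \subseteq [n],\ |X| = r,\ y_x \in [k_x] \text{ for each } x \in X \bigr\},$$ let $\mathcal{L}_{\mathbf{k},0} = \emptyset$, and let $\mathcal{L}_{\mathbf{k},\le n} = \bigcup_{r=0}^{n} \mathcal{L}_{\mathbf{k},r}$ be the family of all labeled sets. Call a family $\mathcal{A}$ of sets intersecting if $A \cap B \neq \emptyset$ for all $A, B \in \mathcal{A}$ (including $A = B$). Then $\mathcal{L}_{\mathbf{k},\le n}$ has the star property at $\{(1,1)\}$; that is, the star $\{A \in \mathcal{L}_{\mathbf{k},\le n} : (1,1) \in A\}$ is a largest intersecting sub-family of $\mathcal{L}_{\mathbf{k},\le n}$: it is intersecting, and every intersecting sub-family $\mathcal{A} \subseteq \mathcal{L}_{\mathbf{k},\le n}$ satisfies $$|\mathcal{A}| \le \bigl|\{A \in \mathcal{L}_{\mathbf{k},\le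 n} : (1,1) \in A\}\bigr|.$$ -/

import Mathlib

/-- The sub-family `𝓕(T) = {F ∈ 𝓕 : T ⊆ F}`. -/
def starAt {α : Type*} [DecidableEq α] (𝓕 : Finset (Finset α)) (T : Finset α) :
    Finset (Finset α) :=
  𝓕.filter fun F => T ⊆ F

/-- `𝓐` is `t`-intersecting: `|A ∩ B| ≥ t` for any `A, B ∈ 𝓐` (including `A = B`). -/
def IsTIntersecting {α : Type*} [DecidableEq α] (t : ℕ) (𝓐 : Finset (Finset α)) : Prop :=
  ∀ A ∈ 𝓐, ∀ B ∈ 𝓐, t ≤ (A ∩ B).card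

/-- `𝓐` is a largest `t`-intersecting sub-family of `𝓕`. -/
def IsLargestTIntersecting {α : Type*} [DecidableEq α] (t : ℕ)
    (𝓕 𝓐 : Finset (Finset α)) : Prop :=
  𝓐 ⊆ 𝓕 ∧ IsTIntersecting t 𝓐 ∧
    ∀ 𝓑 : Finset (Finset α), 𝓑 ⊆ 𝓕 → IsTIntersecting t 𝓑 → 𝓑.card ≤ 𝓐.card

/-- `𝓕` has the `t`-star property at `T`: `T` is a `t`-set and `𝓕(T)` is a largest
`t`-intersecting sub-family of `𝓕`. -/
def HasTStarPropertyAt {α : Type*} [DecidableEq α] (t : ℕ) (𝓕 : Finset (Finset α))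
    (T : Finset α) : Prop :=
  T.card = t ∧ IsLargestTIntersecting t 𝓕 (starAt 𝓕 T)

/-- The star property at `T` is the `1`-star property at `T`. -/
def HasStarPropertyAt {α : Type*} [DecidableEq α] (𝓕 : Finset (Finset α))
    (T : Finset α) : Prop :=
  HasTStarPropertyAt 1 𝓕 T

/-- The labeled sets with index set `X`: all `{(x, y_x) : x ∈ X}` with `y_x ∈ [k_x]`
for each `x ∈ X`. -/
def labeledSetsOn (k : ℕ → ℕ) (X : Finset ℕ) : Finset (Finset (ℕ × ℕ)) :=
  (X.pi fun x => Finset.Icc 1 (k x)).image fun y => X.attach.image fun x => (x.1, y x.1 x.2)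

/-- The family `𝓛_{𝐤,r}` of labeled `r`-sets for `𝐤 = (k 1, …, k n)`; by convention
`𝓛_{𝐤,0} = ∅`. -/
def labeledSets (n : ℕ) (k : ℕ → ℕ) (r : ℕ) : Finset (Finset (ℕ × ℕ)) :=
  if r = 0 then ∅
  else (Finset.powersetCard r (Finset.Icc 1 n)).biUnion fun X => labeledSetsOn k X

/-- The family `𝓛_{𝐤,≤r} = ⋃_{i=0}^{r} 𝓛_{𝐤,i}`. -/
def labeledSetsLE (n : ℕ) (k : ℕ → ℕ) (r : ℕ) : Finset (Finset (ℕ × ℕ)) :=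
  (Finset.range (r + 1)).biUnion fun i => labeledSets n k i

/-! Reading "no label" as `0` turns labeled sets into the nonzero elements of the group `∏ ZMod (k i
+ 1)`. Translate any `g` by the constants `0, …, k 1`. As `k 1` is the least `k a`, these translates
differ pairwise in every coordinate, so their graphs are disjoint and an intersecting family
contains at most one. At coordinate `1` they run through all residues, so one lies in the star.
Averaging over `g` gives the bound. -/

/-- Partial labelings of `{1, …, n}`: the value `0` at `i` means that `i` carries no label. -/
abbrev PartialLabeling (n : ℕ) (k : ℕ → ℕ) : Type :=
  (i : Finset.Icc 1 n) → ZMod (k i + 1)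

/-- The graph of a partial labeling, as a labeled set. -/
def PartialLabeling.graph {n : ℕ} {k : ℕ → ℕ} (g : PartialLabeling n k) : Finset (ℕ × ℕ) :=
  (Finset.univ.filter fun i : Finset.Icc 1 n => (g i).val ≠ 0).image
    fun i : Finset.Icc 1 n => ((i : ℕ), (g i).val)

namespace PartialLabeling

variable {n : ℕ} {k : ℕ → ℕ}

theorem mem_graph {g : PartialLabeling n k} {a b : ℕ} :
    (a, b) ∈ g.graph ↔ ∃ h : a ∈ Finset.Icc 1 n, b ≠ 0 ∧ (g ⟨a, h⟩).val = b := by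
  simp only [graph, Finset.mem_image, Finset.mem_filter, Finset.mem_univ, true_and,
    Prod.mk.injEq]
  constructor
  · rintro ⟨i, hi, rfl, rfl⟩
    exact ⟨i.2, hi, rfl⟩
  · rintro ⟨h, hb, rfl⟩
    exact ⟨⟨a, h⟩, hb, rfl, rfl⟩

theorem graph_injective : Function.Injective (graph : PartialLabeling n k → _) := by
  intro g g' h
  have key : ∀ {g g' : PartialLabeling n k}, g.graph = g'.graph →
      ∀ i, (g i).val ≠ 0 → (g' i).val = (g i).val := by
    intro g g' h i hi
    have hm : ((i : ℕ), (g i).val) ∈ g.graph := mem_graph.2 ⟨i.2, hi, rfl⟩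
    rw [h] at hm
    obtain ⟨_, _, h2⟩ := mem_graph.1 hm
    exact h2
  funext i
  apply ZMod.val_injective
  by_cases hi : (g i).val = 0
  · by_cases hi' : (g' i).val = 0
    · rw [hi, hi']
    · exact key h.symm i hi'
  · exact (key h i hi).symm

theorem exists_graph_eq {A : Finset (ℕ × ℕ)} (hA : A ∈ labeledSetsLE n k n) :
    ∃ g : PartialLabeling n k, g.graph = A := by
  simp only [labeledSetsLE, Finset.mem_biUnion, labeledSets] at hA
  obtain ⟨r, -, hA⟩ := hA
  split_ifs at hA with hr
  · simp at hA
  simp only [Finset.mem_biUnion, Finset.mem_powersetCard, labeledSetsOn, Finset.mem_image,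
    Finset.mem_pi, Finset.mem_Icc] at hA
  obtain ⟨X, ⟨hX, -⟩, y, hy, rfl⟩ := hA
  refine ⟨fun i => if h : (i : ℕ) ∈ X then ((y i h : ℕ) : ZMod (k i + 1)) else 0, ?_⟩
  have hval : ∀ a (h : a ∈ X), ((y a h : ℕ) : ZMod (k a + 1)).val = y a h := fun a h =>
    ZMod.val_natCast_of_lt (Nat.lt_succ_of_le (hy a h).2)
  ext ⟨a, b⟩
  rw [mem_graph]
  simp only [Finset.mem_image, Finset.mem_attach, true_and, Subtype.exists, Prod.mk.injEq]
  constructor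
  · rintro ⟨ha, hb, hab⟩
    by_cases h : a ∈ X
    · rw [dif_pos h, hval] at hab
      exact ⟨a, h, rfl, hab⟩
    · rw [dif_neg h, ZMod.val_zero] at hab
      exact absurd hab.symm hb
  · rintro ⟨a, h, rfl, rfl⟩
    refine ⟨hX h, ?_, ?_⟩
    · have := (hy a h).1
      omega
    · rw [dif_pos h, hval]

theorem graph_mem_labeledSetsLE {g : PartialLabeling n k} (hg : g.graph.Nonempty) :
    g.graph ∈ labeledSetsLE n k n := by
  obtain ⟨⟨a, b⟩, hab⟩ := hg
  obtain ⟨ha, hb, hab⟩ := mem_graph.1 hab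
  let X : Finset ℕ :=
    (Finset.Icc 1 n).filter fun a => ∃ h : a ∈ Finset.Icc 1 n, (g ⟨a, h⟩).val ≠ 0
  have hXn : X ⊆ Finset.Icc 1 n := Finset.filter_subset _ _
  have haX : a ∈ X := Finset.mem_filter.2 ⟨ha, ha, by rwa [hab]⟩
  have hne : ∀ a (h : a ∈ X), (g ⟨a, hXn h⟩).val ≠ 0 := fun a h =>
    (Finset.mem_filter.1 h).2.2
  have hcard : X.card ≤ n := by simpa using Finset.card_le_card hXn
  simp only [labeledSetsLE, Finset.mem_biUnion, labeledSets]
  refine ⟨X.card, Finset.mem_range.2 (Nat.lt_succ_of_le hcard), ?_⟩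
  -- Nonemptiness matters here: level `0` is empty by convention.
  rw [if_neg (Finset.card_ne_zero_of_mem haX)]
  simp only [Finset.mem_biUnion, Finset.mem_powersetCard, labeledSetsOn, Finset.mem_image,
    Finset.mem_pi, Finset.mem_Icc]
  refine ⟨X, ⟨hXn, rfl⟩, fun a h => (g ⟨a, hXn h⟩).val, fun a h =>
    ⟨Nat.one_le_iff_ne_zero.2 (hne a h), Nat.le_of_lt_succ (ZMod.val_lt _)⟩, ?_⟩
  ext ⟨a, b⟩
  rw [mem_graph]
  simp only [Finset.mem_image, Finset.mem_attach, true_and, Subtype.exists, Prod.mk.injEq]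
  constructor
  · rintro ⟨a, h, rfl, rfl⟩
    exact ⟨hXn h, hne a h, rfl⟩
  · rintro ⟨ha, hb, rfl⟩
    exact ⟨a, Finset.mem_filter.2 ⟨ha, ha, hb⟩, rfl, rfl⟩

/-- Translates of a partial labeling by distinct small constants have disjoint graphs. -/
theorem eq_of_mem_graph_add {g : PartialLabeling n k} {m i j : ℕ}
    (hm : ∀ a ∈ Finset.Icc 1 n, m ≤ k a) (hi : i ≤ m) (hj : j ≤ m) {p : ℕ × ℕ}
    (hpi : p ∈ graph (fun a => g a + (i : ZMod (k a + 1))))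
    (hpj : p ∈ graph (fun a => g a + (j : ZMod (k a + 1)))) : i = j := by
  obtain ⟨a, b⟩ := p
  obtain ⟨ha, -, h1⟩ := mem_graph.1 hpi
  obtain ⟨_, -, h2⟩ := mem_graph.1 hpj
  have h3 := add_left_cancel (ZMod.val_injective _ (h1.trans h2.symm))
  have hk : m ≤ k (⟨a, ha⟩ : Finset.Icc 1 n) := hm a ha
  have h4 := congrArg ZMod.val h3
  rwa [ZMod.val_natCast_of_lt (by omega), ZMod.val_natCast_of_lt (by omega)] at h4

end PartialLabeling

/-- Double counting over translates: if every translate of `t` meets `B` in at most as many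
indices as it meets `S`, then `B` is at most as large as `S`. -/
theorem card_le_card_of_translates {G ι : Type*} [AddGroup G] [Fintype G] [DecidableEq G]
    (J : Finset ι) (hJ : J.Nonempty) (t : ι → G) (B S : Finset G)
    (h : ∀ g, (J.filter fun j => g + t j ∈ B).card ≤ (J.filter fun j => g + t j ∈ S).card) :
    B.card ≤ S.card := by
  -- For each fixed `j`, translation by `t j` is a bijection of `G`, so it hits `C` exactly `C.card`
  -- times.
  have key : ∀ C : Finset G, ∑ g : G, (J.filter fun j => g + t j ∈ C).card = J.card * C.card := by
    intro C
    simp only [Finset.card_filter]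
    rw [Finset.sum_comm, Finset.sum_const_nat]
    intro j _
    refine (Equiv.sum_comp (Equiv.addRight (t j)) (fun g => if g ∈ C then 1 else 0)).trans ?_
    simp
  have := Finset.sum_le_sum fun g (_ : g ∈ Finset.univ) => h g
  rw [key, key] at this
  exact Nat.le_of_mul_le_mul_left this hJ.card_pos

open PartialLabeling in
/-- An intersecting family of labeled sets is at most as large as the star at `(1, 1)`. -/
theorem card_le_card_starAt_labeledSetsLE {n : ℕ} (hn : 1 ≤ n) {k : ℕ → ℕ} (hk1 : 1 ≤ k 1)
    (hk : ∀ a ∈ Finset.Icc 1 n, k 1 ≤ k a) {𝓑 : Finset (Finset (ℕ × ℕ))}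
    (h𝓑 : 𝓑 ⊆ labeledSetsLE n k n) (hint : IsTIntersecting 1 𝓑) :
    𝓑.card ≤ (starAt (labeledSetsLE n k n) {((1 : ℕ), (1 : ℕ))}).card := by
  classical
  let o : Finset.Icc 1 n := ⟨1, Finset.mem_Icc.2 ⟨le_rfl, hn⟩⟩
  have hone : ((1 : ℕ) : ZMod (k o + 1)).val = 1 :=
    ZMod.val_natCast_of_lt (show 1 < k 1 + 1 by omega)
  let B : Finset (PartialLabeling n k) := Finset.univ.filter fun g => g.graph ∈ 𝓑
  let S : Finset (PartialLabeling n k) := Finset.univ.filter fun g => g o = (1 : ℕ)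
  have hB : 𝓑.card ≤ B.card := by
    refine (Finset.card_le_card fun A hA => ?_).trans
      (Finset.card_image_le (f := PartialLabeling.graph))
    obtain ⟨g, rfl⟩ := exists_graph_eq (h𝓑 hA)
    exact Finset.mem_image_of_mem _ (Finset.mem_filter.2 ⟨Finset.mem_univ _, hA⟩)
  have hS : S.card ≤ (starAt (labeledSetsLE n k n) {((1 : ℕ), (1 : ℕ))}).card := by
    refine Finset.card_le_card_of_injOn PartialLabeling.graph (fun g hg => ?_)
      graph_injective.injOn
    have hg : g o = (1 : ℕ) := (Finset.mem_filter.1 hg).2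
    have hm : ((1 : ℕ), (1 : ℕ)) ∈ g.graph :=
      mem_graph.2 ⟨o.2, one_ne_zero, (congrArg ZMod.val hg).trans hone⟩
    exact Finset.mem_coe.2 (Finset.mem_filter.2
      ⟨graph_mem_labeledSetsLE ⟨_, hm⟩, Finset.singleton_subset_iff.2 hm⟩)
  refine hB.trans (le_trans ?_ hS)
  refine card_le_card_of_translates (Finset.range (k 1 + 1)) ⟨0, by simp⟩
    (fun j => fun a : Finset.Icc 1 n => ((j : ℕ) : ZMod (k a + 1))) B S fun g => ?_
  refine le_trans (b := 1) (Finset.card_le_one.2 fun i hi j hj => ?_)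
    -- The shift by `1 - g o` gives `o` the label `1`; its representative is at most `k 1`, hence an
    -- allowed shift.
    (Finset.card_pos.2 ⟨((1 : ℕ) - g o : ZMod (k o + 1)).val, ?_⟩)
  · obtain ⟨hi, hiB⟩ := Finset.mem_filter.1 hi
    obtain ⟨hj, hjB⟩ := Finset.mem_filter.1 hj
    obtain ⟨p, hp⟩ := Finset.card_pos.1
      (hint _ (Finset.mem_filter.1 hiB).2 _ (Finset.mem_filter.1 hjB).2)
    obtain ⟨hpi, hpj⟩ := Finset.mem_inter.1 hp
    exact eq_of_mem_graph_add hk (Nat.le_of_lt_succ (Finset.mem_range.1 hi))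
      (Nat.le_of_lt_succ (Finset.mem_range.1 hj)) hpi hpj
  · refine Finset.mem_filter.2 ⟨Finset.mem_range.2 (ZMod.val_lt (n := k o + 1) _),
      Finset.mem_filter.2 ⟨Finset.mem_univ _, ?_⟩⟩
    rw [Pi.add_apply, ZMod.natCast_zmod_val, add_sub_cancel]

theorem mainTheorem3 (n : ℕ) (hn : 1 ≤ n) (k : ℕ → ℕ) (hk1 : 1 ≤ k 1)
    (hk : MonotoneOn k (Set.Icc 1 n)) :
    HasStarPropertyAt (labeledSetsLE n k n) {((1 : ℕ), (1 : ℕ))} := by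
  refine ⟨Finset.card_singleton _, Finset.filter_subset _ _, fun A hA B hB => ?_,
    fun 𝓑 h𝓑 hint => card_le_card_starAt_labeledSetsLE hn hk1 (fun a ha => ?_) h𝓑 hint⟩
  · have hA := Finset.singleton_subset_iff.1 (Finset.mem_filter.1 hA).2
    have hB := Finset.singleton_subset_iff.1 (Finset.mem_filter.1 hB).2
    exact Finset.card_pos.2 ⟨_, Finset.mem_inter.2 ⟨hA, hB⟩⟩
  · have ha := Finset.mem_Icc.1 ha
    exact hk ⟨le_rfl, hn⟩ ha ha.1
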